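/- For a commutative ring $R$ and an integer $n\ge 0$, let $\mathrm{ca}^{n}(R)$ denote the ideal of all $a\in R$ such that $a\cdot\mathrm{Ext}^{i}_{R}(M,N)=0$ for all finitely generated $R$-modules $M,N$ and all integers $i\ge n$. Let $k$ be a field, let $d\ge 0$ be an integer, and let $S$ be either the polynomial ring $k[x_1,\dots,x_d]$ or the formal power series ring $k[[x_1,\dots,x_d]]$ in commuting indeterminates over $k$. Let $G$ be a finite subgroup of the group of $k$-algebra automorphisms of $S$, and let $S^{G}=\{s\in S : g(s)=s \text{ for all } g\in G\}$ be the ring of invariants. Then the ideal $\mathrm{ca}^{d+1}(S^{G})$ is non-zero. -/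

import Mathlib

universe u

open CategoryTheory

/-- The `n`-th cohomology annihilator ideal `ca^n(R)` of a commutative ring `R`: the elements `a`
of `R` that annihilate `Ext^i_R(M, N)` for all finitely generated `R`-modules `M`, `N` and all
`i ≥ n`.  (The centre of `R` is `R` itself.  Finitely generated modules over `R : Type u` all have
isomorphic copies in `ModuleCat.{u} R`, so no module is lost.) -/
noncomputable def cohomologyAnnihilator (R : Type u) [CommRing R] (n : ℕ) : Ideal R where
  carrier := {a | ∀ M N : ModuleCat.{u} R, Module.Finite R M → Module.Finite R N →
    ∀ i : ℕ, n ≤ i → ∀ e : Abelian.Ext.{u} M N i, a • e = 0}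
  zero_mem' := fun _ _ _ _ _ _ e => zero_smul R e
  add_mem' := fun {a b} ha hb M N hM hN i hi e => by
    rw [add_smul, ha M N hM hN i hi e, hb M N hM hN i hi e, add_zero]
  smul_mem' := fun c a ha M N hM hN i hi e => by
    rw [smul_eq_mul, mul_smul, ha M N hM hN i hi e, smul_zero]

/-! Write R for the invariant ring and τ for the trace S → R. A denominator-free dual basis, ∑ s_j
h(t_j) = b·δ_{h,1} with b ≠ 0, gives ∑ s_j τ(t_j x) = b x. So multiplication by b, and hence by its
norm N ∈ R, factors on S through a finite free R-module (`exists_sum_mul_smul_eq_ite`). Therefore N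
kills Ext^{≥1}_R(W, -) for W projective over S, and shifting along an S-resolution of length d shows
that N^{d+1} kills Ext^{≥d+1}_R(W, -) for W of projective dimension at most d. For an R-module M,
multiplication by τ(t) factors through the S-module S ⊗ M, so τ(t) N^{d+1} lies in the annihilator;
it is non-zero for some t = t_j because R is a domain. The bound d on projective dimension is
Hilbert's syzygy theorem, proved by induction on the number of variables in both cases. -/

open scoped TensorProduct

/-! ### Elements annihilating Ext, and their transfer along R → S. -/

section ExtAnnihilation

variable {R : Type u} [CommRing R]

/-- The element `r` annihilates `Ext^i_R(X, Y)` for all `R`-modules `Y` and all `i ≥ n`. -/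
def AnnihilatesExtFrom (r : R) (X : ModuleCat.{u} R) (n : ℕ) : Prop :=
  ∀ (Y : ModuleCat.{u} R) (i : ℕ), n ≤ i → ∀ e : Abelian.Ext.{u} X Y i, r • e = 0

theorem AnnihilatesExtFrom.of_factor {r s : R} {X P : ModuleCat.{u} R} {n : ℕ}
    (hP : AnnihilatesExtFrom s P n) (f : X ⟶ P) (g : P ⟶ X) (hfg : f ≫ g = r • 𝟙 X) :
    AnnihilatesExtFrom (r * s) X n := by
  intro Y i hi e
  have h : r • e = (Abelian.Ext.mk₀ f).comp ((Abelian.Ext.mk₀ g).comp e (zero_add i))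
      (zero_add i) := by
    rw [← Abelian.Ext.comp_assoc_of_second_deg_zero, Abelian.Ext.mk₀_comp_mk₀, hfg,
      Abelian.Ext.mk₀_smul, Abelian.Ext.smul_comp, Abelian.Ext.mk₀_id_comp]
  rw [mul_comm, mul_smul, h, ← Abelian.Ext.comp_smul, hP Y i hi, Abelian.Ext.comp_zero]

theorem annihilatesExtFrom_of_projective (P : ModuleCat.{u} R) [Projective P] :
    AnnihilatesExtFrom (1 : R) P 1 := by
  intro Y i hi e
  obtain ⟨i, rfl⟩ := Nat.exists_eq_add_of_le' hi
  rw [e.eq_zero_of_projective, smul_zero]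

/-- Dimension shifting: s • e dies on the middle term, so it comes from Ext of the first term one
degree lower, where r kills it. -/
theorem AnnihilatesExtFrom.of_shortExact {r s : R} {S : ShortComplex (ModuleCat.{u} R)}
    (hS : S.ShortExact) {n : ℕ} (h₁ : AnnihilatesExtFrom r S.X₁ (n + 1))
    (h₂ : AnnihilatesExtFrom s S.X₂ 1) : AnnihilatesExtFrom (s * r) S.X₃ (n + 2) := by
  intro Y i hi e
  obtain ⟨i, rfl⟩ : ∃ j, i = 1 + j := ⟨i - 1, by omega⟩
  obtain ⟨x, hx⟩ := Abelian.Ext.contravariant_sequence_exact₃ hS Y (s • e)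
    (by rw [Abelian.Ext.comp_smul]; exact h₂ Y _ (by omega) _) rfl
  rw [mul_comm, mul_smul, ← hx, ← Abelian.Ext.comp_smul, h₁ Y i (by omega), Abelian.Ext.comp_zero]

variable {S : Type u} [CommRing S] [Algebra R S]

/-- If multiplication by `b` on the `R`-algebra `S` factors through a free `R`-module, then
`b` annihilates `Ext^i_R(W, -)` for `i ≥ 1` and every projective `S`-module `W`. -/
theorem annihilatesExtFrom_of_projective_algebra {b : R} {F : Type u} [AddCommGroup F] [Module R F]
    [Module.Free R F] (f : S →ₗ[R] F) (g : F →ₗ[R] S) (hfg : ∀ x, g (f x) = b • x)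
    (W : Type u) [AddCommGroup W] [Module R W] [Module S W] [IsScalarTower R S W]
    [Module.Projective S W] : AnnihilatesExtFrom b (ModuleCat.of R W) 1 := by
  obtain ⟨s, hs⟩ := (Module.projective_def' (R := S) (P := W)).mp inferInstance
  let f' : W →ₗ[R] (W →₀ F) := (Finsupp.mapRange.linearMap f) ∘ₗ (s.restrictScalars R)
  let g' : (W →₀ F) →ₗ[R] W :=
    ((Finsupp.linearCombination S (id : W → W)).restrictScalars R) ∘ₗ Finsupp.mapRange.linearMap g
  have hfg' : ∀ w, g' (f' w) = b • w := by
    intro w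
    have h : Finsupp.mapRange.linearMap g (Finsupp.mapRange.linearMap f (s w)) = b • s w := by
      ext x
      simp [hfg]
    have h' := LinearMap.congr_fun hs w
    simp only [LinearMap.comp_apply, LinearMap.id_apply] at h'
    simp only [f', g', LinearMap.comp_apply, LinearMap.restrictScalars_apply, h]
    rw [LinearMap.map_smul_of_tower, h']
  have : Projective (ModuleCat.of R (W →₀ F)) :=
    (IsProjective.iff_projective (R := R) (W →₀ F)).mp inferInstance
  have := (annihilatesExtFrom_of_projective (ModuleCat.of R (W →₀ F))).of_factor (r := b)
    (X := ModuleCat.of R W) (ModuleCat.ofHom f') (ModuleCat.ofHom g')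
    (by ext w; simpa using hfg' w)
  rwa [mul_one] at this

/-- Syzygies are taken over S but Ext over R; each of the n shifts costs one factor b, and the last,
projective syzygy costs one more. -/
theorem annihilatesExtFrom_of_hasProjectiveDimensionLE {b : R} {F : Type u} [AddCommGroup F]
    [Module R F] [Module.Free R F] (f : S →ₗ[R] F) (g : F →ₗ[R] S)
    (hfg : ∀ x, g (f x) = b • x) (n : ℕ) (W : Type u) [AddCommGroup W] [Module R W] [Module S W]
    [IsScalarTower R S W] (hW : HasProjectiveDimensionLE (ModuleCat.of S W) n) :
    AnnihilatesExtFrom (b ^ (n + 1)) (ModuleCat.of R W) (n + 1) := by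
  induction n generalizing W with
  | zero =>
    rw [← projective_iff_hasProjectiveDimensionLE_zero, ← IsProjective.iff_projective] at hW
    simpa using annihilatesExtFrom_of_projective_algebra f g hfg W
  | succ n ih =>
    let p : (W →₀ S) →ₗ[S] W := Finsupp.linearCombination S id
    have hp : Function.Surjective p := Finsupp.linearCombination_id_surjective S W
    have hK : HasProjectiveDimensionLE (ModuleCat.of S (LinearMap.ker p)) n :=
      ((LinearMap.shortExact_shortComplexKer hp).hasProjectiveDimensionLT_X₃_iff n
        ((IsProjective.iff_projective (R := S) (W →₀ S)).mp inferInstance)).mp hW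
    let K := LinearMap.ker p
    let T : ShortComplex (ModuleCat.{u} R) := ShortComplex.mk
      (X₁ := ModuleCat.of R K) (X₂ := ModuleCat.of R (W →₀ S)) (X₃ := ModuleCat.of R W)
      (ModuleCat.ofHom (K.subtype.restrictScalars R)) (ModuleCat.ofHom (p.restrictScalars R))
      (ModuleCat.hom_ext (LinearMap.ext fun x => x.2))
    have hT : T.ShortExact := ModuleCat.shortComplex_shortExact T
      (fun x => ⟨fun hx => ⟨⟨x, hx⟩, rfl⟩, by rintro ⟨y, rfl⟩; exact y.2⟩)
      (Submodule.injective_subtype _) hp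
    have := AnnihilatesExtFrom.of_shortExact hT (ih (LinearMap.ker p) hK)
      (annihilatesExtFrom_of_projective_algebra f g hfg (W →₀ S))
    rwa [← pow_succ'] at this

/-- If multiplication by `b` on the `R`-algebra `S` factors through a free `R`-module,
`c` is the image of an element under an `R`-linear map `S → R`, and finitely generated `S`-modules
have projective dimension at most `n`, then `c * b ^ (n + 1)` lies in `ca^{n+1}(R)`. -/
theorem mul_pow_mem_cohomologyAnnihilator {b : R} {F : Type u} [AddCommGroup F]
    [Module R F] [Module.Free R F] (f : S →ₗ[R] F) (g : F →ₗ[R] S)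
    (hfg : ∀ x, g (f x) = b • x) (τ : S →ₗ[R] R) (t : S) (n : ℕ)
    (hS : ∀ M : ModuleCat.{u} S, Module.Finite S M → HasProjectiveDimensionLE M n) :
    τ t * b ^ (n + 1) ∈ cohomologyAnnihilator R (n + 1) := by
  intro M N hM _ i hi e
  let α : M →ₗ[R] S ⊗[R] M := TensorProduct.mk R S M t
  let β : S ⊗[R] M →ₗ[R] M := (TensorProduct.lid R M).toLinearMap ∘ₗ τ.rTensor M
  have hαβ : ∀ m, β (α m) = τ t • m := fun m => by simp [α, β]
  exact (annihilatesExtFrom_of_hasProjectiveDimensionLE f g hfg n (S ⊗[R] M)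
    (hS (ModuleCat.of S (S ⊗[R] M)) inferInstance)).of_factor (X := M) (ModuleCat.ofHom α)
    (ModuleCat.ofHom β) (by ext m; simpa using hαβ m) N i hi e

end ExtAnnihilation

/-! ### Dual bases for a faithful finite group action. -/

section GaloisTrace

variable {S G : Type*} [CommRing S] [IsDomain S] [Group G] [Finite G] [MulSemiringAction G S]
  [FaithfulSMul G S]

/-- A denominator-free form of the normalised dual basis of a Galois extension. -/
theorem exists_sum_mul_smul_eq_ite [DecidableEq G] : ∃ (n : ℕ) (s t : Fin n → S) (b : S), b ≠ 0 ∧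
    ∀ h : G, ∑ j, s j * h • t j = if h = 1 then b else 0 := by
  classical
  cases nonempty_fintype G
  -- Functions of the form h ↦ ∑ s_j h(t_j) are closed under products, so it suffices to find, for
  -- each g ≠ 1, one that vanishes at g but not at 1: h ↦ g(x) - h(x) with x moved by g.
  let P : (G → S) → Prop := fun φ =>
    ∃ (n : ℕ) (s t : Fin n → S), ∀ h, ∑ j, s j * h • t j = φ h
  have hmul : ∀ φ ψ, P φ → P ψ → P (φ * ψ) := by
    rintro φ ψ ⟨n, s, t, hst⟩ ⟨m, s', t', hst'⟩
    refine ⟨n * m, fun j => s (finProdFinEquiv.symm j).1 * s' (finProdFinEquiv.symm j).2,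
      fun j => t (finProdFinEquiv.symm j).1 * t' (finProdFinEquiv.symm j).2, fun h => ?_⟩
    rw [Pi.mul_apply, ← hst, ← hst', Finset.sum_mul_sum, ← Fintype.sum_prod_type']
    refine Fintype.sum_equiv finProdFinEquiv.symm _ _ fun j => ?_
    rw [smul_mul']
    ring
  have hprod : ∀ (A : Finset G) (φ : G → G → S), (∀ g ∈ A, P (φ g)) → P (∏ g ∈ A, φ g) := by
    intro A φ hφ
    refine Finset.prod_induction φ P hmul ⟨1, 1, 1, fun h => by simp⟩ hφ
  have hne : ∀ g : G, g ≠ 1 → ∃ x : S, g • x ≠ x := by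
    intro g hg
    by_contra! H
    exact hg (FaithfulSMul.eq_of_smul_eq_smul (α := S) fun x => by rw [H x, one_smul])
  choose! x hx using hne
  obtain ⟨n, s, t, hst⟩ := hprod (Finset.univ.erase 1) (fun g h => g • x g - h • x g) fun g _ =>
    ⟨2, ![g • x g, -1], ![1, x g], fun h => by simp [Fin.sum_univ_two, sub_eq_add_neg]⟩
  refine ⟨n, s, t, ∏ g ∈ Finset.univ.erase (1 : G), (g • x g - x g), ?_, fun h => ?_⟩
  · exact Finset.prod_ne_zero_iff.mpr fun g hg => sub_ne_zero.mpr (hx g (Finset.ne_of_mem_erase hg))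
  · rw [hst, Finset.prod_apply]
    split_ifs with h1
    · simp [h1]
    · exact Finset.prod_eq_zero (Finset.mem_erase.mpr ⟨h1, Finset.mem_univ h⟩) (sub_self _)

end GaloisTrace

/-! ### The trace, the norm and the non-zero annihilating element. -/

section FixedPoints

variable (k S G : Type*) [Field k] [CommRing S] [Algebra k S] [Group G] [Fintype G]
  [MulSemiringAction G S] [SMulCommClass G k S]

/-- The trace `x ↦ ∑ g, g • x` onto the ring of invariants. -/
def traceFixedPoints : S →ₗ[FixedPoints.subalgebra k S G] FixedPoints.subalgebra k S G where
  toFun x := ⟨∑ g : G, g • x, fun h => by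
    simp only [Finset.smul_sum, ← mul_smul]
    exact Fintype.sum_equiv (Equiv.mulLeft h) _ _ fun _ => rfl⟩
  map_add' x y := Subtype.ext (by simp [Finset.sum_add_distrib])
  map_smul' r x := Subtype.ext (by
    have h : ∀ g : G, g • (r : S) = r := r.2
    simp [Algebra.smul_def, Finset.mul_sum, h])

end FixedPoints

theorem cohomologyAnnihilator_fixedPoints_ne_bot (k S G : Type u) [Field k] [CommRing S]
    [IsDomain S] [Algebra k S] [Group G] [Finite G] [MulSemiringAction G S] [SMulCommClass G k S]
    [FaithfulSMul G S] (n : ℕ)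
    (hS : ∀ M : ModuleCat.{u} S, Module.Finite S M → HasProjectiveDimensionLE M n) :
    cohomologyAnnihilator (FixedPoints.subalgebra k S G) (n + 1) ≠ ⊥ := by
  classical
  cases nonempty_fintype G
  obtain ⟨m, s, t, b, hb, hst⟩ := exists_sum_mul_smul_eq_ite (S := S) (G := G)
  let τ := traceFixedPoints k S G
  -- The element b need not be invariant; its norm is, and the product c of the other conjugates
  -- turns b into N.
  let N : FixedPoints.subalgebra k S G := ⟨∏ g : G, g • b, fun h => by
    rw [Finset.smul_prod']
    simp only [← mul_smul]
    exact Fintype.prod_equiv (Equiv.mulLeft h) _ _ fun _ => rfl⟩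
  have hN : N ≠ 0 := by
    refine fun h => Finset.prod_ne_zero_iff.mpr (fun g _ => ?_) (congrArg Subtype.val h)
    exact (smul_ne_zero_iff_ne g).mpr hb
  let c : S := ∏ g ∈ Finset.univ.erase (1 : G), g • b
  have hc : c * b = N := by
    have := Finset.prod_erase_mul Finset.univ (fun g : G => g • b) (Finset.mem_univ 1)
    rwa [one_smul] at this
  have key : ∀ x, ∑ j, s j * (τ (t j * x) : S) = b * x := by
    intro x
    have : ∀ j, s j * (τ (t j * x) : S) = ∑ g : G, s j * g • t j * g • x := fun j => by
      simp only [τ, traceFixedPoints, LinearMap.coe_mk, AddHom.coe_mk, Finset.mul_sum, smul_mul',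
        mul_assoc]
    simp only [this]
    rw [Finset.sum_comm]
    simp only [← Finset.sum_mul, hst]
    simp
  -- If τ vanished on every t_j, the trace identity at x = 1 would give b = 0.
  obtain ⟨j, hj⟩ : ∃ j, τ (t j) ≠ 0 := by
    by_contra! H
    have := key 1
    simp only [mul_one, H] at this
    exact hb (by simpa using this.symm)
  let f : S →ₗ[FixedPoints.subalgebra k S G] (Fin m → FixedPoints.subalgebra k S G) :=
    LinearMap.pi fun j => τ ∘ₗ LinearMap.mulLeft _ (t j)
  let g : (Fin m → FixedPoints.subalgebra k S G) →ₗ[FixedPoints.subalgebra k S G] S :=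
    LinearMap.mulLeft _ c ∘ₗ Fintype.linearCombination _ s
  have hfg : ∀ x, g (f x) = N • x := by
    intro x
    have : ∑ j, τ (t j * x) • s j = b * x := by
      rw [← key x]
      exact Finset.sum_congr rfl fun j _ => mul_comm _ _
    simp only [f, g, LinearMap.comp_apply, LinearMap.mulLeft_apply,
      Fintype.linearCombination_apply, LinearMap.pi_apply, this]
    rw [← mul_assoc, hc]
    rfl
  refine fun hbot => mul_ne_zero hj (pow_ne_zero (n + 1) hN) ?_
  rw [← Ideal.mem_bot, ← hbot]
  exact mul_pow_mem_cohomologyAnnihilator f g hfg τ (t j) n hS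

/-! ### Projective dimension under ring isomorphism and flat base change. -/

section

variable {A B : Type u} [CommRing A] [CommRing B]

/-- Projective dimension is invariant under transport of structure along a ring isomorphism. -/
theorem hasProjectiveDimensionLE_of_ringEquiv (e : A ≃+* B) (N : ModuleCat.{u} B) (n : ℕ)
    (h : HasProjectiveDimensionLE ((ModuleCat.restrictScalars (e : A →+* B)).obj N) n) :
    HasProjectiveDimensionLE N n :=
  let := RingHomInvPair.of_ringEquiv e
  let := RingHomInvPair.symm (e : A →+* B) (e.symm : B →+* A)
  ModuleCat.hasProjectiveDimensionLE_of_semiLinearEquiv e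
    (M := (ModuleCat.restrictScalars (e : A →+* B)).obj N)
    { toFun := fun x => x
      invFun := fun x => x
      map_add' := fun _ _ => rfl
      map_smul' := fun _ _ => rfl
      left_inv := fun _ => rfl
      right_inv := fun _ => rfl } n

/-- Flat base change does not increase projective dimension. -/
theorem hasProjectiveDimensionLE_tensorProduct_of_flat [Algebra A B] [Module.Flat A B] (n : ℕ)
    (M : Type u) [AddCommGroup M] [Module A M] (h : HasProjectiveDimensionLE (ModuleCat.of A M) n) :
    HasProjectiveDimensionLE (ModuleCat.of B (B ⊗[A] M)) n := by
  induction n generalizing M with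
  | zero =>
    rw [← projective_iff_hasProjectiveDimensionLE_zero, ← IsProjective.iff_projective] at h ⊢
    infer_instance
  | succ n ih =>
    let p : (M →₀ A) →ₗ[A] M := Finsupp.linearCombination A id
    have hp : Function.Surjective p := Finsupp.linearCombination_id_surjective A M
    let K := LinearMap.ker p
    have hK : HasProjectiveDimensionLE (ModuleCat.of A K) n :=
      ((LinearMap.shortExact_shortComplexKer hp).hasProjectiveDimensionLT_X₃_iff n
        ((IsProjective.iff_projective (R := A) (M →₀ A)).mp inferInstance)).mp h
    have hex : Function.Exact (K.subtype.baseChange B) (p.baseChange B) :=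
      have : Function.Exact K.subtype p := LinearMap.exact_subtype_ker_map p
      lTensor_exact (M := K) (N := M →₀ A) (P := M) B this hp
    let T : ShortComplex (ModuleCat.{u} B) := ShortComplex.mk
      (X₁ := ModuleCat.of B (B ⊗[A] K)) (X₂ := ModuleCat.of B (B ⊗[A] (M →₀ A)))
      (X₃ := ModuleCat.of B (B ⊗[A] M))
      (ModuleCat.ofHom (K.subtype.baseChange B)) (ModuleCat.ofHom (p.baseChange B))
      (ModuleCat.hom_ext hex.linearMap_comp_eq_zero)
    have hT : T.ShortExact := ModuleCat.shortComplex_shortExact T hex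
      (Module.Flat.lTensor_preserves_injective_linearMap _ K.injective_subtype)
      (LinearMap.lTensor_surjective B hp)
    exact (hT.hasProjectiveDimensionLT_X₃_iff n
      ((IsProjective.iff_projective (R := B) (B ⊗[A] (M →₀ A))).mp inferInstance)).mpr (ih K hK)

end

/-! ### Hilbert's syzygy theorem for polynomial rings. -/

section Polynomial

open Polynomial

variable {A : Type u} [CommRing A] (M : Type u) [AddCommGroup M] [Module A M] [Module A[X] M]
  [IsScalarTower A A[X] M]

/-- The endomorphism `X ⊗ 1 - 1 ⊗ X` of `A[X] ⊗ M`. -/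
noncomputable def tensorSubX : A[X] ⊗[A] M →ₗ[A[X]] A[X] ⊗[A] M :=
  (X : A[X]) • LinearMap.id - ((LinearMap.lsmul A[X] M X).restrictScalars A).baseChange A[X]

/-- The multiplication map `A[X] ⊗ M → M`. -/
noncomputable def tensorAct : A[X] ⊗[A] M →ₗ[A[X]] M :=
  LinearMap.liftBaseChange A[X] LinearMap.id

@[simp]
theorem tensorSubX_tmul (p : A[X]) (m : M) :
    tensorSubX M (p ⊗ₜ m) = (X * p) ⊗ₜ m - p ⊗ₜ ((X : A[X]) • m) := by
  simp [tensorSubX, TensorProduct.smul_tmul']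

@[simp]
theorem tensorAct_tmul (p : A[X]) (m : M) : tensorAct M (p ⊗ₜ m) = p • m := by
  simp [tensorAct]

/-- Modulo the image, X can be moved across the tensor sign, so every z is congruent to 1 ⊗ (its
image in M). -/
theorem exact_tensorSubX_tensorAct : Function.Exact (tensorSubX (A := A) M) (tensorAct M) := by
  have hmem : ∀ z : A[X] ⊗[A] M,
      z - (1 : A[X]) ⊗ₜ[A] tensorAct M z ∈ LinearMap.range (tensorSubX M) := by
    intro z
    induction z with
    | zero => simp
    | add x y hx hy =>
      have := add_mem hx hy
      rwa [sub_add_sub_comm, ← TensorProduct.tmul_add, ← map_add] at this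
    | tmul p m =>
      rw [tensorAct_tmul]
      induction p using Polynomial.induction_on' generalizing m with
      | add p q hp hq =>
        have := add_mem (hp m) (hq m)
        rwa [sub_add_sub_comm, ← TensorProduct.tmul_add, ← TensorProduct.add_tmul,
          ← add_smul] at this
      | monomial i a =>
        induction i generalizing m with
        | zero =>
          have : (monomial 0 a : A[X]) = a • 1 := by simp [Algebra.smul_def]
          simp [this, TensorProduct.smul_tmul]
        | succ i ih =>
          have h : (monomial (i + 1) a : A[X]) = X * monomial i a := by
            rw [X_mul_monomial]
          have h1 : tensorSubX M (monomial i a ⊗ₜ m) ∈ LinearMap.range (tensorSubX M) := ⟨_, rfl⟩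
          have := add_mem h1 (ih ((X : A[X]) • m))
          rwa [tensorSubX_tmul, ← h, sub_add_sub_cancel, ← mul_smul, mul_comm, ← h] at this
  intro z
  constructor
  · intro hz
    simpa [hz] using hmem z
  · rintro ⟨w, rfl⟩
    induction w with
    | zero => simp
    | add x y hx hy => simp [hx, hy]
    | tmul p m => simp [← mul_smul, mul_comm]

/-- Coefficients of a kernel element satisfy z_i = X z_{i+1}, so z_i = X^j z_{i+j}, which vanishes
for large j. -/
theorem tensorSubX_injective : Function.Injective (tensorSubX (A := A) M) := by
  let e := PolynomialModule.polynomialTensorProductLEquivPolynomialModule A M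
  have he : ∀ (p : A[X]) (m : M) (i : ℕ), (e (p ⊗ₜ m)).coeff i = p.coeff i • m := by
    intro p m i
    have : e (p ⊗ₜ m) = p • PolynomialModule.single A 0 m :=
      LinearMap.liftBaseChange_tmul _ _ _ _
    rw [this, PolynomialModule.smul_single_apply]
    simp
  have hsub : ∀ x y : PolynomialModule A M, (x - y).coeff = x.coeff - y.coeff :=
    map_sub (PolynomialModule.coeffLinearEquiv (R := A) (S := A) (M := M))
  have hc : ∀ (z : A[X] ⊗[A] M) (i : ℕ), (e (tensorSubX M z)).coeff (i + 1) =
      (e z).coeff i - (X : A[X]) • (e z).coeff (i + 1) := by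
    intro z i
    induction z with
    | zero => simp
    | add x y hx hy =>
      simp only [map_add, PolynomialModule.coeff_add, Finsupp.add_apply, hx, hy, smul_add]
      abel
    | tmul p m =>
      rw [tensorSubX_tmul, map_sub, hsub, Finsupp.sub_apply, he, he, he, he,
        coeff_X_mul, smul_comm]
  rw [injective_iff_map_eq_zero]
  intro z hz
  have hstep : ∀ i, (e z).coeff i = (X : A[X]) • (e z).coeff (i + 1) := fun i =>
    sub_eq_zero.mp (by rw [← hc, hz, map_zero]; rfl)
  have hpow : ∀ i j, (e z).coeff i = (X : A[X]) ^ j • (e z).coeff (i + j) := by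
    intro i j
    induction j with
    | zero => simp
    | succ j ih => rw [ih, hstep, ← mul_smul, ← pow_succ, add_assoc]
  obtain ⟨b, hb⟩ := (e z).coeff.support.bddAbove
  refine e.map_eq_zero_iff.mp (PolynomialModule.coeff_injective (Finsupp.ext fun i => ?_))
  have : (e z).coeff (i + (b + 1)) = 0 := by
    by_contra h
    have := hb (Finsupp.mem_support_iff.mpr h)
    omega
  rw [hpow i (b + 1), this, smul_zero]
  rfl

/-- If every `A`-module has projective dimension at most `n`, then every `A[X]`-module has
projective dimension at most `n + 1`. -/
theorem hasProjectiveDimensionLE_polynomial {n : ℕ}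
    (hA : ∀ M : ModuleCat.{u} A, HasProjectiveDimensionLE M n) (M : ModuleCat.{u} A[X]) :
    HasProjectiveDimensionLE M (n + 1) := by
  let : Module A M := Module.compHom M (C : A →+* A[X])
  have : IsScalarTower A A[X] M := ⟨fun a p m => by
    rw [smul_eq_C_mul, mul_smul]; rfl⟩
  have h := hasProjectiveDimensionLE_tensorProduct_of_flat (B := A[X]) n M (hA (ModuleCat.of A M))
  let T : ShortComplex (ModuleCat.{u} A[X]) := ShortComplex.mk
    (X₁ := ModuleCat.of A[X] (A[X] ⊗[A] M)) (X₂ := ModuleCat.of A[X] (A[X] ⊗[A] M)) (X₃ := M)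
    (ModuleCat.ofHom (tensorSubX M)) (ModuleCat.ofHom (tensorAct M))
    (ModuleCat.hom_ext (exact_tensorSubX_tensorAct M).linearMap_comp_eq_zero)
  have hT : T.ShortExact := ModuleCat.shortComplex_shortExact T (exact_tensorSubX_tensorAct M)
    (tensorSubX_injective M) (fun m => ⟨1 ⊗ₜ m, by simp [T]⟩)
  exact hT.hasProjectiveDimensionLT_X₃ (n + 1) h
    (hasProjectiveDimensionLT_of_ge _ (n + 1) (n + 2) (Nat.le_succ _))

theorem hasProjectiveDimensionLE_mvPolynomial (k : Type u) [Field k] (d : ℕ)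
    (M : ModuleCat.{u} (MvPolynomial (Fin d) k)) : HasProjectiveDimensionLE M d := by
  induction d with
  | zero =>
    refine hasProjectiveDimensionLE_of_ringEquiv
      (MvPolynomial.isEmptyRingEquiv k (Fin 0)).symm M 0 ?_
    rw [← projective_iff_hasProjectiveDimensionLE_zero, ← IsProjective.iff_projective]
    have := Module.Free.of_divisionRing k
      ((ModuleCat.restrictScalars
        ((MvPolynomial.isEmptyRingEquiv k (Fin 0)).symm : k →+* MvPolynomial (Fin 0) k)).obj M)
    exact Module.Projective.of_free
  | succ d ih =>
    exact hasProjectiveDimensionLE_of_ringEquiv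
      (MvPolynomial.finSuccEquiv k d).symm.toRingEquiv M (d + 1)
      (hasProjectiveDimensionLE_polynomial ih _)

end Polynomial

/-! ### Projective dimension modulo a regular element. -/

section RegularElement

variable {A : Type u} [CommRing A] [IsLocalRing A] [IsNoetherianRing A]

/-- If `x` is regular on a finitely generated module `N` over a noetherian local ring `A`, then the
projective dimension of `N` over `A` is at most that of `N / x N` over `A / (x)`. -/
theorem hasProjectiveDimensionLE_of_quotSMulTop {x : A} (hx : x ∈ IsLocalRing.maximalIdeal A)
    (hxA : IsSMulRegular A x) (n : ℕ) (N : Type u) [AddCommGroup N] [Module A N] [Module.Finite A N]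
    (hN : IsSMulRegular N x)
    (h : HasProjectiveDimensionLE (ModuleCat.of (A ⧸ Ideal.span {x}) (QuotSMulTop x N)) n) :
    HasProjectiveDimensionLE (ModuleCat.of A N) n := by
  have hlocal : IsLocalRing (A ⧸ Ideal.span {x}) :=
    have : Nontrivial (A ⧸ Ideal.span {x}) := Ideal.Quotient.nontrivial_iff.mpr
      fun h => (IsLocalRing.mem_maximalIdeal x).mp hx (Ideal.span_singleton_eq_top.mp h)
    IsLocalRing.of_surjective' (Ideal.Quotient.mk (Ideal.span {x})) Ideal.Quotient.mk_surjective
  induction n generalizing N with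
  | zero =>
    rw [← projective_iff_hasProjectiveDimensionLE_zero, ← IsProjective.iff_projective] at h ⊢
    have : Module.Finite (A ⧸ Ideal.span {x}) (QuotSMulTop x N) :=
      Module.Finite.of_restrictScalars_finite A _ _
    have : Module.FinitePresentation A N := Module.finitePresentation_of_finite A N
    have hfree : Module.Free (A ⧸ Ideal.span {x}) (QuotSMulTop x N) :=
      Module.free_of_flat_of_isLocalRing
    have hxJ : x ∈ (⊥ : Ideal A).jacobson := by
      rwa [IsLocalRing.jacobson_eq_maximalIdeal _ bot_ne_top]
    have := (Module.free_quotSMulTop_iff_free A N hxJ hN).mp hfree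
    infer_instance
  | succ n ih =>
    obtain ⟨m, p, hp⟩ := Module.Finite.exists_fin' A N
    let K := LinearMap.ker p
    have hex : Function.Exact K.subtype p := LinearMap.exact_subtype_ker_map p
    have hT : (LinearMap.shortComplexKer p).ShortExact := LinearMap.shortExact_shortComplexKer hp
    let i' : QuotSMulTop x K →ₗ[A ⧸ Ideal.span {x}] QuotSMulTop x (Fin m → A) :=
      (QuotSMulTop.map x K.subtype).extendScalarsOfSurjective Ideal.Quotient.mk_surjective
    let p' : QuotSMulTop x (Fin m → A) →ₗ[A ⧸ Ideal.span {x}] QuotSMulTop x N :=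
      (QuotSMulTop.map x p).extendScalarsOfSurjective Ideal.Quotient.mk_surjective
    have hp' : Function.Surjective p' := QuotSMulTop.map_surjective x hp
    have hex' : Function.Exact i' p' := QuotSMulTop.map_exact x hex hp
    -- Reduction modulo x keeps the left map injective because x is regular on N, that is,
    -- Tor_1(A/(x), N) = 0.
    have hi' : Function.Injective i' := by
      have h0 : Function.Exact (0 : PUnit.{u + 1} →ₗ[A] K) K.subtype :=
        (LinearMap.exact_zero_iff_injective _ _).mpr K.injective_subtype
      have h1 := QuotSMulTop.map_first_exact_on_four_term_exact_of_isSMulRegular_last h0 hex hN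
      rw [map_zero] at h1
      exact (LinearMap.exact_zero_iff_injective _ _).mp h1
    let T : ShortComplex (ModuleCat.{u} (A ⧸ Ideal.span {x})) := ShortComplex.mk
      (X₁ := ModuleCat.of _ (QuotSMulTop x K)) (X₂ := ModuleCat.of _ (QuotSMulTop x (Fin m → A)))
      (X₃ := ModuleCat.of _ (QuotSMulTop x N)) (ModuleCat.ofHom i') (ModuleCat.ofHom p')
      (ModuleCat.hom_ext hex'.linearMap_comp_eq_zero)
    have hT' : T.ShortExact := ModuleCat.shortComplex_shortExact T hex' hi' hp'
    exact (hT.hasProjectiveDimensionLT_X₃_iff n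
      ((IsProjective.iff_projective (R := A) (Fin m → A)).mp inferInstance)).mpr <|
      ih K ((IsSMulRegular.pi fun _ => hxA).submodule K x) <|
      (hT'.hasProjectiveDimensionLT_X₃_iff n
      ((IsProjective.iff_projective (R := A ⧸ Ideal.span {x}) (QuotSMulTop x (Fin m → A))).mp
        inferInstance)).mp h

/-- If `x` is a regular element in the maximal ideal of a noetherian local ring `A` and finitely
generated `A / (x)`-modules have projective dimension at most `n`, then finitely generated
`A`-modules have projective dimension at most `n + 1`. -/
theorem hasProjectiveDimensionLE_succ_of_quotient {x : A} (hx : x ∈ IsLocalRing.maximalIdeal A)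
    (hxA : IsSMulRegular A x) {n : ℕ}
    (h : ∀ M : ModuleCat.{u} (A ⧸ Ideal.span {x}), Module.Finite (A ⧸ Ideal.span {x}) M →
      HasProjectiveDimensionLE M n) (M : ModuleCat.{u} A) [Module.Finite A M] :
    HasProjectiveDimensionLE M (n + 1) := by
  obtain ⟨m, p, hp⟩ := Module.Finite.exists_fin' A M
  -- The element x may be a zero divisor on M, but it is regular on the syzygy K inside a free
  -- module; this accounts for the extra 1.
  let K := LinearMap.ker p
  have hT : (LinearMap.shortComplexKer p).ShortExact := LinearMap.shortExact_shortComplexKer hp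
  have : Module.Finite (A ⧸ Ideal.span {x}) (QuotSMulTop x K) :=
    Module.Finite.of_restrictScalars_finite A _ _
  exact (hT.hasProjectiveDimensionLT_X₃_iff n
    ((IsProjective.iff_projective (R := A) (Fin m → A)).mp inferInstance)).mpr <|
    hasProjectiveDimensionLE_of_quotSMulTop hx hxA n K
      ((IsSMulRegular.pi fun _ => hxA).submodule K x) (h (ModuleCat.of _ (QuotSMulTop x K)) this)

end RegularElement

/-! ### The syzygy theorem for power series rings. -/

section PowerSeries

/-- Finite generation is preserved by transport of structure along a ring isomorphism. -/
theorem finite_restrictScalars_of_ringEquiv {A B : Type u} [CommRing A] [CommRing B] (e : A ≃+* B)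
    (N : ModuleCat.{u} B) (hN : Module.Finite B N) :
    Module.Finite A ((ModuleCat.restrictScalars (e : A →+* B)).obj N) := by
  let := RingHomInvPair.of_ringEquiv e
  let := RingHomInvPair.symm (e : A →+* B) (e.symm : B →+* A)
  let f : N →ₛₗ[(e.symm : B →+* A)] (ModuleCat.restrictScalars (e : A →+* B)).obj N :=
    { toFun := fun x => x
      map_add' := fun _ _ => rfl
      map_smul' := fun b x => by
        change b • x = e (e.symm b) • x
        rw [e.apply_symm_apply] }
  exact Module.Finite.of_surjective f Function.surjective_id

open PowerSeries in
-- The variable X is regular, lies in the maximal ideal, and has quotient A.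
theorem hasProjectiveDimensionLE_powerSeries {A : Type u} [CommRing A] [IsLocalRing A]
    [IsNoetherianRing A] {n : ℕ}
    (hA : ∀ M : ModuleCat.{u} A, Module.Finite A M → HasProjectiveDimensionLE M n)
    (M : ModuleCat.{u} A⟦X⟧) [Module.Finite A⟦X⟧ M] : HasProjectiveDimensionLE M (n + 1) := by
  have hspan : Ideal.span {(X : A⟦X⟧)} = RingHom.ker (constantCoeff (R := A)) := by
    ext f
    rw [RingHom.mem_ker, Ideal.mem_span_singleton, X_dvd_iff]
  let e : A ≃+* A⟦X⟧ ⧸ Ideal.span {(X : A⟦X⟧)} :=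
    ((Ideal.quotEquivOfEq hspan).trans
      (RingHom.quotientKerEquivOfSurjective constantCoeff_surj)).symm
  refine hasProjectiveDimensionLE_succ_of_quotient (x := (X : A⟦X⟧)) ?_ ?_ (fun N hN => ?_) M
  · rw [IsLocalRing.mem_maximalIdeal, mem_nonunits_iff, isUnit_iff_constantCoeff]
    simp
  · intro f g hfg
    exact PowerSeries.X_mul_cancel hfg
  · exact hasProjectiveDimensionLE_of_ringEquiv e N n
      (hA _ (finite_restrictScalars_of_ringEquiv e N hN))

theorem hasProjectiveDimensionLE_mvPowerSeries (k : Type u) [Field k] (d : ℕ)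
    (M : ModuleCat.{u} (MvPowerSeries (Fin d) k)) (hM : Module.Finite (MvPowerSeries (Fin d) k) M) :
    HasProjectiveDimensionLE M d := by
  induction d with
  | zero =>
    let e : k ≃+* MvPowerSeries (Fin 0) k := (MvPowerSeries.isEmptyEquiv (Fin 0) k).symm.toRingEquiv
    refine hasProjectiveDimensionLE_of_ringEquiv e M 0 ?_
    rw [← projective_iff_hasProjectiveDimensionLE_zero, ← IsProjective.iff_projective]
    have := Module.Free.of_divisionRing k
      ((ModuleCat.restrictScalars (e : k →+* MvPowerSeries (Fin 0) k)).obj M)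
    exact Module.Projective.of_free
  | succ d ih =>
    let e := (MvPowerSeries.finSuccEquiv k d).symm.toRingEquiv
    have := finite_restrictScalars_of_ringEquiv e M hM
    exact hasProjectiveDimensionLE_of_ringEquiv e M (d + 1)
      (hasProjectiveDimensionLE_powerSeries ih _)

end PowerSeries

theorem corollary6p9 (k : Type u) [Field k] (d : ℕ) :
    (∀ (G : Subgroup (MvPolynomial (Fin d) k ≃ₐ[k] MvPolynomial (Fin d) k)) [Finite G],
      cohomologyAnnihilator (FixedPoints.subalgebra k (MvPolynomial (Fin d) k) G) (d + 1) ≠ ⊥) ∧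
    (∀ (G : Subgroup (MvPowerSeries (Fin d) k ≃ₐ[k] MvPowerSeries (Fin d) k)) [Finite G],
      cohomologyAnnihilator (FixedPoints.subalgebra k (MvPowerSeries (Fin d) k) G) (d + 1) ≠ ⊥) :=
  ⟨fun G _ => cohomologyAnnihilator_fixedPoints_ne_bot k (MvPolynomial (Fin d) k) G d
    fun M _ => hasProjectiveDimensionLE_mvPolynomial k d M,
  fun G _ =>
    have := NoZeroDivisors.to_isDomain (MvPowerSeries (Fin d) k)
    cohomologyAnnihilator_fixedPoints_ne_bot k (MvPowerSeries (Fin d) k) G d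
    (hasProjectiveDimensionLE_mvPowerSeries k d)⟩
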